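/- **Theorem.** Let $C\subset\mathbb{R}^n$ be a polytope (the convex hull of finitely many points) with the origin in its interior, and let $C^\circ=\{y:\langle x,y\rangle\le 1 \text{ for all } x\in C\}$ be its polar. Let $S_C$ be the slack matrix of $C$: its rows are indexed by the vertices $v$ of $C$, its columns by the extreme points $y$ of $C^\circ$ (which correspond to the facets $\{x\in C:\langle x,y\rangle=1\}$ of $C$), and $S_C(v,y)=1-\langle v,y\rangle$. Let $\operatorname{supp}(S_C)$ be the $0/1$ matrix obtained from $S_C$ by replacing every nonzero entry by $1$. Let $L(C)$ be the lattice of all faces of $C$ (including $\emptyset$ and $C$), ordered by inclusion, and let $2^{[k]}$ be the lattice of all subsets of $[k]=\{1,\dots,k\}$. 1. For every integer $k\ge 0$ the following are equivalent: - $\operatorname{supp}(S_C)$ has a Boolean factorization of intermediate dimension $k$, that is, $\operatorname{supp}(S_C)=AB$ in Boolean arithmetic ($1+1=1$) for some $0/1$ matrices $A$ with $k$ columns and $B$ with $k$ rows; - $L(C)$ embeds into $2^{[k]}$, that is, there is a map $\varphi:L(C)\to 2^{[k]}$ such that $F\subseteq H$ if and only if $\varphi(F)\subseteq\varphi(H)$,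 for all faces $F,H$ of $C$. 2. There is a smallest $k$ for which $L(C)$ embeds into $2^{[k]}$, and for this $k$ one has $\operatorname{rank}_+(C)\ge k$, where $\operatorname{rank}_+(C)$ is the smallest $r$ such that $S_C=AB$ for some entrywise nonnegative real matrices $A$ with $r$ columns and $B$ with $r$ rows ($+\infty$ if there is no such $r$). -/

import Mathlib

namespace PolytopeLift

/-- A polytope: the convex hull of finitely many points. -/
def IsPolytope {n : ℕ} (C : Set (EuclideanSpace ℝ (Fin n))) : Prop :=
  ∃ V : Set (EuclideanSpace ℝ (Fin n)), V.Finite ∧ C = convexHull ℝ V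

/-- The polar `C° = {y | ⟨x, y⟩ ≤ 1 for all x ∈ C}`. -/
def polarBody {n : ℕ} (C : Set (EuclideanSpace ℝ (Fin n))) :
    Set (EuclideanSpace ℝ (Fin n)) :=
  {y | ∀ x ∈ C, inner ℝ x y ≤ 1}

/-- The slack matrix (slack operator) `S_C(x, y) = 1 - ⟨x, y⟩`, with rows indexed by the extreme
points of `C` and columns by the extreme points of its polar. For a polytope with the origin in its
interior the rows are the vertices, and the columns are the facets: the extreme point `y` of the
polar is the facet inequality `1 - ⟨x, y⟩ ≥ 0`, normalized to have value `1` at the origin. -/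
noncomputable def slackMatrix {n : ℕ} (C : Set (EuclideanSpace ℝ (Fin n))) :
    Matrix (Set.extremePoints ℝ C) (Set.extremePoints ℝ (polarBody C)) ℝ :=
  fun x y => 1 - inner ℝ (x : EuclideanSpace ℝ (Fin n)) (y : EuclideanSpace ℝ (Fin n))

open Classical in
/-- The support of a real matrix: every nonzero entry is turned into a one. -/
noncomputable def supp {ι κ : Type*} (M : Matrix ι κ ℝ) : Matrix ι κ Bool :=
  fun i j => decide (M i j ≠ 0)

/-- The product of two `0/1` matrices in Boolean arithmetic (`1 + 1 = 1`): multiplication is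
"and", and the sum over the inner index is "or" (the supremum in `Bool`). -/
noncomputable def boolMul {ι κ : Type*} {k : ℕ} (A : Matrix ι (Fin k) Bool) (B : Matrix (Fin k) κ Bool) :
    Matrix ι κ Bool :=
  fun i j => Finset.univ.sup fun l => (A i l && B l j)

/-- `T` has a Boolean factorization of intermediate dimension `k`. -/
def HasBooleanFactorization {ι κ : Type*} (T : Matrix ι κ Bool) (k : ℕ) : Prop :=
  ∃ (A : Matrix ι (Fin k) Bool) (B : Matrix (Fin k) κ Bool), T = boolMul A B

/-- `M` is the product of two entrywise nonnegative real matrices with inner dimension `k`. -/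
def HasNonnegFactorization {ι κ : Type*} (M : Matrix ι κ ℝ) (k : ℕ) : Prop :=
  ∃ (A : Matrix ι (Fin k) ℝ) (B : Matrix (Fin k) κ ℝ),
    (∀ i l, 0 ≤ A i l) ∧ (∀ l j, 0 ≤ B l j) ∧ M = A * B

/-- The nonnegative rank of `C`: the least `k` such that the slack matrix of `C` has a nonnegative
factorization of intermediate dimension `k`, and `⊤` if there is none. -/
noncomputable def nonnegRank {n : ℕ} (C : Set (EuclideanSpace ℝ (Fin n))) : ℕ∞ :=
  ⨅ (k : ℕ) (_ : HasNonnegFactorization (slackMatrix C) k), (k : ℕ∞)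

/-- The face lattice `L(C)`, ordered by inclusion. A face is the empty set or the set of maximizers
over `C` of some linear functional (so that `C` itself is a face too). -/
abbrev FaceLattice {n : ℕ} (C : Set (EuclideanSpace ℝ (Fin n))) : Type :=
  {F : Set (EuclideanSpace ℝ (Fin n)) // IsExposed ℝ C F}

/-- `L(C)` embeds into the Boolean lattice of all subsets of `{1, …, k}`: there is a map `φ` with
`F ⊆ H ↔ φ F ⊆ φ H`. -/
def EmbedsInBoolean {n : ℕ} (C : Set (EuclideanSpace ℝ (Fin n))) (k : ℕ) : Prop :=
  Nonempty (FaceLattice C ↪o Set (Fin k))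

end PolytopeLift

/-!
Write `V` for the vertices of `C`, `Y` for the extreme points of the polar, and, for `y ∈ Y`,
`F_y = {x ∈ C | ⟨x, y⟩ = 1}`. The support of the slack matrix is the non-incidence matrix: its
`(v, y)` entry is `1` exactly when `v ∉ F_y`.

Two facts of convex geometry connect this matrix with the face lattice. A face lies in a convex
closed set as soon as its vertices do (`IsExposed.subset_of_extremePoints_subset`, from
Krein–Milman in `C`), and every face is the intersection with `C` of the facets containing it
(`IsExposed.mem_of_forall_polar_extremePoint`). For the second, the normalized functional `y₀`
defining a face `H` lies in the extreme subset `polarFace C H` of the polar consisting of all `y`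
with `⟨h, y⟩ = 1` on `H`; Krein–Milman in `polarFace C H` shows that an equation `⟨x, ·⟩ = 1` which
holds at its extreme points, all of which are in `Y`, also holds at `y₀`. The empty face fits in
with `y₀ = 0`, where the equation is absurd. The finiteness of `Y` is never needed.

Given `supp S_C = A B`, send a face to the union of the rows `A v` over its vertices `v`. This is
monotone, and it reflects inclusions: if `y ∈ Y` is `1` on `H`, every index in the image of `H` has
`B l y = 0`, so every vertex of a face whose image is contained in that of `H` lies in `F_y`.
Conversely, an embedding `φ` gives the factorization `A v = φ {v}`, `B · y = (φ F_y)ᶜ`, because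
vertices of polytopes are exposed (`IsPolytope.isExposed_singleton`).

There is a trivial Boolean factorization whose inner dimension is the number of vertices, so a least
`k` exists. Supports of nonnegative matrices multiply in Boolean arithmetic, since no cancellation
occurs, and this gives the bound on the nonnegative rank.
-/

namespace PolytopeLift

/-! ### Faces and their vertices -/

section Faces

variable {E : Type*} [NormedAddCommGroup E] [NormedSpace ℝ E]

/-- Krein–Milman, in the form of a principle for testing inclusions on extreme points. -/
theorem _root_.IsCompact.subset_of_extremePoints_subset {F H : Set E} (hF : IsCompact F)
    (hFc : Convex ℝ F) (hH : IsClosed H) (hHc : Convex ℝ H) (h : F.extremePoints ℝ ⊆ H) :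
    F ⊆ H := by
  rw [← closure_convexHull_extremePoints hF hFc]
  exact closure_minimal (convexHull_min h hHc) hH

theorem _root_.IsExposed.subset_of_extremePoints_subset {C F H : Set E} (hC : IsCompact C)
    (hCc : Convex ℝ C) (hF : IsExposed ℝ C F) (hH : IsClosed H) (hHc : Convex ℝ H)
    (h : ∀ v ∈ C.extremePoints ℝ, v ∈ F → v ∈ H) : F ⊆ H :=
  (hF.isCompact hC).subset_of_extremePoints_subset (hF.convex hCc) hH hHc fun v hv =>
    h v (hF.isExtreme.extremePoints_subset_extremePoints hv) hv.1

end Faces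

variable {n : ℕ} {C : Set (EuclideanSpace ℝ (Fin n))}

theorem IsPolytope.isCompact (hC : IsPolytope C) : IsCompact C := by
  obtain ⟨V, hV, rfl⟩ := hC
  exact hV.isCompact_convexHull (𝕜 := ℝ)

theorem IsPolytope.convex (hC : IsPolytope C) : Convex ℝ C := by
  obtain ⟨V, hV, rfl⟩ := hC
  exact convex_convexHull ℝ V

theorem IsPolytope.finite_extremePoints (hC : IsPolytope C) : (C.extremePoints ℝ).Finite := by
  obtain ⟨V, hV, rfl⟩ := hC
  exact hV.subset extremePoints_convexHull_subset

/-- The vertices of a polytope are exposed. A vertex `v` is strictly separated from the convex hull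
of the other generators; the face on which the separating functional is maximal then has no vertex
but `v`. -/
theorem IsPolytope.isExposed_singleton (hC : IsPolytope C) {v : EuclideanSpace ℝ (Fin n)}
    (hv : v ∈ C.extremePoints ℝ) : IsExposed ℝ C {v} := by
  have hcomp := hC.isCompact
  have hconv := hC.convex
  obtain ⟨V, hV, rfl⟩ := hC
  have hvK : v ∉ convexHull ℝ (V \ {v}) := fun h =>
    (convexHull_min (Set.sdiff_subset_sdiff_left (subset_convexHull ℝ V))
      (hconv.mem_extremePoints_iff_convex_sdiff.1 hv).2 h).2 rfl
  obtain ⟨l, u, hlt, huv⟩ := geometric_hahn_banach_closed_point (convex_convexHull ℝ (V \ {v}))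
    ((hV.subset Set.sdiff_subset).isCompact_convexHull (𝕜 := ℝ)).isClosed hvK
  have hexp : IsExposed ℝ (convexHull ℝ V) (l.toExposed (convexHull ℝ V)) :=
    ContinuousLinearMap.toExposed.isExposed
  have hsub : l.toExposed (convexHull ℝ V) ⊆ {v} := by
    refine hexp.subset_of_extremePoints_subset hcomp hconv isClosed_singleton
      (convex_singleton v) fun w hw hwF => ?_
    by_contra hne
    have h₁ := hlt w (subset_convexHull ℝ _ ⟨extremePoints_convexHull_subset hw, hne⟩)
    have h₂ := hwF.2 v hv.1
    linarith
  obtain ⟨x, hx, hmax⟩ := hcomp.exists_isMaxOn ⟨v, hv.1⟩ l.continuous.continuousOn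
  have hxF : x ∈ l.toExposed (convexHull ℝ V) := ⟨hx, fun y hy => hmax hy⟩
  have hxv : x = v := hsub hxF
  rwa [hsub.antisymm (Set.singleton_subset_iff.2 (hxv ▸ hxF))] at hexp

/-! ### The polar and the facets containing a face -/

theorem polarBody_eq_iInter (C : Set (EuclideanSpace ℝ (Fin n))) :
    polarBody C = ⋂ x ∈ C, {y | innerSL ℝ x y ≤ 1} := by
  ext y
  simp [polarBody]

theorem isClosed_polarBody (C : Set (EuclideanSpace ℝ (Fin n))) : IsClosed (polarBody C) := by
  rw [polarBody_eq_iInter]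
  exact isClosed_biInter fun x _ => isClosed_le (innerSL ℝ x).continuous continuous_const

theorem convex_polarBody (C : Set (EuclideanSpace ℝ (Fin n))) : Convex ℝ (polarBody C) := by
  rw [polarBody_eq_iInter]
  exact convex_iInter₂ fun x _ => convex_halfSpace_le (innerSL ℝ x).isLinear 1

theorem isCompact_polarBody (h0 : (0 : EuclideanSpace ℝ (Fin n)) ∈ interior C) :
    IsCompact (polarBody C) := by
  obtain ⟨r, hr, hball⟩ := Metric.nhds_basis_closedBall.mem_iff.1 (mem_interior_iff_mem_nhds.1 h0)
  refine Metric.isCompact_of_isClosed_isBounded (isClosed_polarBody C)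
    ((Metric.isBounded_closedBall (x := 0) (r := 1 / r)).subset fun y hy => ?_)
  rw [mem_closedBall_zero_iff, le_div_iff₀ hr]
  rcases eq_or_ne y 0 with rfl | hy0
  · simp
  have hn : 0 < ‖y‖ := norm_pos_iff.2 hy0
  have hmem : (r / ‖y‖) • y ∈ C := hball <| by
    rw [mem_closedBall_zero_iff, norm_smul, Real.norm_of_nonneg (by positivity),
      div_mul_cancel₀ _ hn.ne']
  have := hy _ hmem
  rw [real_inner_smul_left, real_inner_self_eq_norm_sq] at this
  calc ‖y‖ * r = r / ‖y‖ * ‖y‖ ^ 2 := by field_simp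
    _ ≤ 1 := this

/-- The face of the polar dual to `H`: the points `y` of the polar with `⟨h, y⟩ = 1` for all
`h ∈ H`. For `H = ∅` this is the whole polar. -/
def polarFace (C H : Set (EuclideanSpace ℝ (Fin n))) : Set (EuclideanSpace ℝ (Fin n)) :=
  {y ∈ polarBody C | ∀ h ∈ H, inner ℝ h y = 1}

theorem polarFace_eq_inter (C H : Set (EuclideanSpace ℝ (Fin n))) :
    polarFace C H = polarBody C ∩ ⋂ h ∈ H, {y | innerSL ℝ h y = 1} := by
  ext y
  simp [polarFace]

theorem isCompact_polarFace (h0 : (0 : EuclideanSpace ℝ (Fin n)) ∈ interior C)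
    (H : Set (EuclideanSpace ℝ (Fin n))) : IsCompact (polarFace C H) := by
  rw [polarFace_eq_inter]
  exact (isCompact_polarBody h0).inter_right <|
    isClosed_biInter fun h _ => isClosed_eq (innerSL ℝ h).continuous continuous_const

theorem convex_polarFace (C H : Set (EuclideanSpace ℝ (Fin n))) : Convex ℝ (polarFace C H) := by
  rw [polarFace_eq_inter]
  exact (convex_polarBody C).inter <|
    convex_iInter₂ fun h _ => convex_hyperplane (innerSL ℝ h).isLinear 1

theorem isExtreme_polarFace {H : Set (EuclideanSpace ℝ (Fin n))} (hHC : H ⊆ C) :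
    IsExtreme ℝ (polarBody C) (polarFace C H) := by
  refine ⟨fun y hy => hy.1, fun y₁ hy₁ y₂ hy₂ y hy hseg => ⟨hy₁, fun h hh => ?_⟩⟩
  obtain ⟨a, b, ha, hb, hab, rfl⟩ := hseg
  have he := hy.2 h hh
  rw [inner_add_right, real_inner_smul_right, real_inner_smul_right] at he
  have h₁ := hy₁ h (hHC hh)
  have h₂ := hy₂ h (hHC hh)
  nlinarith [mul_le_mul_of_nonneg_left h₂ hb.le]

/-- A face other than `C` is cut out by a point of its dual face: the functional which is maximal
on the face is positive somewhere on `C`, as it is nonzero and `C` is a neighbourhood of the origin,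
so it can be normalized to have maximum `1`. The empty face is cut out by `0`. -/
theorem _root_.IsExposed.exists_mem_polarFace
    (h0 : (0 : EuclideanSpace ℝ (Fin n)) ∈ interior C)
    {H : Set (EuclideanSpace ℝ (Fin n))} (hH : IsExposed ℝ C H) (hne : H ≠ C) :
    ∃ y ∈ polarFace C H, ∀ x ∈ C, inner ℝ x y = 1 → x ∈ H := by
  rcases H.eq_empty_or_nonempty with rfl | hHne
  · exact ⟨0, ⟨fun x _ => by simp, fun h hh => hh.elim⟩, fun x _ hx => by simp at hx⟩
  obtain ⟨l, hl⟩ := hH hHne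
  obtain ⟨h, hh⟩ := hHne
  have hhC : h ∈ C ∧ ∀ y ∈ C, l y ≤ l h := by rw [hl] at hh; exact hh
  have hM : 0 < l h := by
    by_contra hM
    have hle : ∀ y ∈ C, l y ≤ 0 := fun y hy => (hhC.2 y hy).trans (not_lt.1 hM)
    obtain ⟨r, hr, hball⟩ :=
      Metric.nhds_basis_closedBall.mem_iff.1 (mem_interior_iff_mem_nhds.1 h0)
    have hzero : ∀ x, l x = 0 := fun x => by
      rcases eq_or_ne x 0 with rfl | hx
      · simp
      have hn : 0 < ‖x‖ := norm_pos_iff.2 hx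
      have hc : 0 < r / ‖x‖ := by positivity
      have key : ‖(r / ‖x‖) • x‖ ≤ r := by
        rw [norm_smul, Real.norm_of_nonneg hc.le, div_mul_cancel₀ _ hn.ne']
      have h₁ := hle _ (hball (mem_closedBall_zero_iff.2 key))
      have h₂ := hle _ (hball (mem_closedBall_zero_iff.2 ((norm_neg _).trans_le key)))
      rw [map_neg, neg_nonpos] at h₂
      have h₃ := le_antisymm h₁ h₂
      rw [map_smul, smul_eq_mul] at h₃
      exact (mul_eq_zero.1 h₃).resolve_left hc.ne'
    refine hne (hl.trans (Set.Subset.antisymm (fun x hx => hx.1) fun x hx => ⟨hx, fun y _ => ?_⟩))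
    rw [hzero, hzero]
  set y₀ := (l h)⁻¹ • (InnerProductSpace.toDual ℝ (EuclideanSpace ℝ (Fin n))).symm l with hy₀
  have hin : ∀ x, inner ℝ x y₀ = (l h)⁻¹ * l x := fun x => by
    rw [hy₀, real_inner_smul_right, real_inner_comm, InnerProductSpace.toDual_symm_apply]
  refine ⟨y₀, ⟨fun x hx => ?_, fun x hx => ?_⟩, fun x hx hx1 => ?_⟩
  · rw [hin, inv_mul_le_one₀ hM]
    exact hhC.2 x hx
  · rw [hl] at hx
    rw [hin, le_antisymm (hhC.2 x hx.1) (hx.2 h hhC.1), inv_mul_cancel₀ hM.ne']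
  · rw [hin, inv_mul_eq_one₀ hM.ne'] at hx1
    rw [hl]
    exact ⟨hx, fun y hy => hx1 ▸ hhC.2 y hy⟩

/-- Every face is the intersection with `C` of the facets containing it. -/
theorem _root_.IsExposed.mem_of_forall_polar_extremePoint
    (h0 : (0 : EuclideanSpace ℝ (Fin n)) ∈ interior C)
    {H : Set (EuclideanSpace ℝ (Fin n))} (hH : IsExposed ℝ C H)
    {x : EuclideanSpace ℝ (Fin n)} (hx : x ∈ C)
    (h : ∀ y ∈ (polarBody C).extremePoints ℝ, (∀ z ∈ H, inner ℝ z y = 1) → inner ℝ x y = 1) :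
    x ∈ H := by
  rcases eq_or_ne H C with rfl | hne
  · exact hx
  obtain ⟨y₀, hy₀, hcut⟩ := hH.exists_mem_polarFace h0 hne
  have hsub : polarFace C H ⊆ {y | innerSL ℝ x y = 1} :=
    (isCompact_polarFace h0 H).subset_of_extremePoints_subset (convex_polarFace C H)
      (isClosed_eq (innerSL ℝ x).continuous continuous_const)
      (convex_hyperplane (innerSL ℝ x).isLinear 1) fun y hy =>
        h y ((isExtreme_polarFace hH.subset).extremePoints_subset_extremePoints hy) hy.1.2
  exact hcut x hx (hsub hy₀)

/-- A point of the polar gives a face, possibly empty. -/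
theorem isExposed_inner_eq_one {y : EuclideanSpace ℝ (Fin n)} (hy : y ∈ polarBody C) :
    IsExposed ℝ C {x ∈ C | inner ℝ x y = 1} := by
  rintro ⟨w, hwC, hw⟩
  refine ⟨innerSL ℝ y, Set.ext fun x => and_congr_right fun hx => ?_⟩
  simp only [innerSL_apply_apply, real_inner_comm _ y]
  exact ⟨fun h z hz => h ▸ hy z hz, fun h => le_antisymm (hy x hx) (hw ▸ h w hwC)⟩

/-! ### Boolean and nonnegative factorizations -/

section Factorizations

variable {ι κ : Type*} {k : ℕ}

theorem supp_eq_true_iff {M : Matrix ι κ ℝ} {i : ι} {j : κ} :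
    supp M i j = true ↔ M i j ≠ 0 := by
  simp [supp]

theorem boolMul_eq_true_iff {A : Matrix ι (Fin k) Bool} {B : Matrix (Fin k) κ Bool} {i : ι}
    {j : κ} : boolMul A B i j = true ↔ ∃ l, A i l = true ∧ B l j = true := by
  simp only [boolMul, ← Bool.and_eq_true]
  constructor
  · intro h
    by_contra! hne
    have hbot : (Finset.univ.sup fun l => (A i l && B l j)) = ⊥ :=
      (Finset.sup_eq_bot_iff _ _).2 fun l _ => by simpa using hne l
    rw [h] at hbot
    exact absurd hbot (by decide)
  · rintro ⟨l, hl⟩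
    have := Finset.le_sup (f := fun l => (A i l && B l j)) (Finset.mem_univ l)
    exact this hl

/-- A Boolean factorization assigns a set of inner indices to each row and each column, so that an
entry is `1` exactly when the sets of its row and its column meet. -/
theorem hasBooleanFactorization_iff {T : Matrix ι κ Bool} :
    HasBooleanFactorization T k ↔ ∃ (a : ι → Set (Fin k)) (b : κ → Set (Fin k)),
      ∀ i j, T i j = true ↔ ∃ l, l ∈ a i ∧ l ∈ b j := by
  classical
  constructor
  · rintro ⟨A, B, rfl⟩
    exact ⟨fun i => {l | A i l = true}, fun j => {l | B l j = true}, fun i j =>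
      boolMul_eq_true_iff⟩
  · rintro ⟨a, b, h⟩
    refine ⟨.of fun i l => decide (l ∈ a i), .of fun l j => decide (l ∈ b j), ?_⟩
    ext i j
    rw [Bool.eq_iff_iff, h, boolMul_eq_true_iff]
    simp

/-- The trivial factorization `T = 1 * T`. -/
theorem exists_hasBooleanFactorization [Finite ι] (T : Matrix ι κ Bool) :
    ∃ k, HasBooleanFactorization T k := by
  obtain ⟨k, ⟨e⟩⟩ := Finite.exists_equiv_fin ι
  refine ⟨k, hasBooleanFactorization_iff.2
    ⟨fun i => {e i}, fun j => {l | T (e.symm l) j = true}, fun i j => ?_⟩⟩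
  simp

/-- Sums of nonnegative reals do not cancel, so supports multiply in Boolean arithmetic. -/
theorem HasNonnegFactorization.hasBooleanFactorization_supp {M : Matrix ι κ ℝ}
    (h : HasNonnegFactorization M k) : HasBooleanFactorization (supp M) k := by
  obtain ⟨A, B, hA, hB, rfl⟩ := h
  refine hasBooleanFactorization_iff.2
    ⟨fun i => {l | A i l ≠ 0}, fun j => {l | B l j ≠ 0}, fun i j => ?_⟩
  rw [supp_eq_true_iff, Matrix.mul_apply, Ne,
    Finset.sum_eq_zero_iff_of_nonneg fun l _ => mul_nonneg (hA i l) (hB l j)]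
  simp [not_or]

end Factorizations

/-! ### Factorizations of the slack pattern and embeddings of the face lattice -/

theorem supp_slackMatrix_eq_true_iff {v : C.extremePoints ℝ} {y : (polarBody C).extremePoints ℝ} :
    supp (slackMatrix C) v y = true ↔
      inner ℝ (v : EuclideanSpace ℝ (Fin n)) (y : EuclideanSpace ℝ (Fin n)) ≠ 1 := by
  rw [supp_eq_true_iff, slackMatrix, sub_ne_zero]
  exact ne_comm

theorem embedsInBoolean_of_hasBooleanFactorization (hC : IsPolytope C)
    (h0 : (0 : EuclideanSpace ℝ (Fin n)) ∈ interior C) {k : ℕ}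
    (h : HasBooleanFactorization (supp (slackMatrix C)) k) : EmbedsInBoolean C k := by
  obtain ⟨a, b, hab⟩ := hasBooleanFactorization_iff.1 h
  let φ : FaceLattice C → Set (Fin k) := fun F =>
    {l | ∃ v : C.extremePoints ℝ, (v : EuclideanSpace ℝ (Fin n)) ∈ F.1 ∧ l ∈ a v}
  refine ⟨OrderEmbedding.ofMapLEIff φ fun F H => ⟨fun hle => ?_, ?_⟩⟩
  · refine F.2.subset_of_extremePoints_subset hC.isCompact hC.convex
      (H.2.isCompact hC.isCompact).isClosed (H.2.convex hC.convex) fun v hv hvF => ?_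
    refine H.2.mem_of_forall_polar_extremePoint h0 hv.1 fun y hy hyH => ?_
    by_contra hne
    obtain ⟨l, hla, hlb⟩ := (hab ⟨v, hv⟩ ⟨y, hy⟩).1 (supp_slackMatrix_eq_true_iff.2 hne)
    -- The index `l` also occurs at some vertex of `H`, where the slack of `y` vanishes.
    obtain ⟨w, hwH, hlw⟩ := hle (show l ∈ φ F from ⟨⟨v, hv⟩, hvF, hla⟩)
    exact supp_slackMatrix_eq_true_iff.1 ((hab w ⟨y, hy⟩).2 ⟨l, hlw, hlb⟩) (hyH w hwH)
  · rintro hFH l ⟨v, hv, hl⟩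
    exact ⟨v, hFH hv, hl⟩

theorem hasBooleanFactorization_of_embedsInBoolean (hC : IsPolytope C) {k : ℕ}
    (h : EmbedsInBoolean C k) : HasBooleanFactorization (supp (slackMatrix C)) k := by
  obtain ⟨φ⟩ := h
  let vert : C.extremePoints ℝ → FaceLattice C := fun v => ⟨{v.1}, hC.isExposed_singleton v.2⟩
  let facet : (polarBody C).extremePoints ℝ → FaceLattice C := fun y =>
    ⟨{x ∈ C | inner ℝ x y.1 = 1}, isExposed_inner_eq_one y.2.1⟩
  refine hasBooleanFactorization_iff.2
    ⟨fun v => φ (vert v), fun y => (φ (facet y))ᶜ, fun v y => ?_⟩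
  have hle : vert v ≤ facet y ↔
      inner ℝ (v : EuclideanSpace ℝ (Fin n)) (y : EuclideanSpace ℝ (Fin n)) = 1 :=
    Set.singleton_subset_iff.trans (and_iff_right v.2.1)
  rw [supp_slackMatrix_eq_true_iff, Ne, ← hle, ← φ.le_iff_le]
  exact Set.not_subset

end PolytopeLift

theorem mainTheorem7 {n : ℕ} (C : Set (EuclideanSpace ℝ (Fin n)))
    (hC : PolytopeLift.IsPolytope C) (h0 : (0 : EuclideanSpace ℝ (Fin n)) ∈ interior C) :
    (∀ k : ℕ,
      PolytopeLift.HasBooleanFactorization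
          (PolytopeLift.supp (PolytopeLift.slackMatrix C)) k ↔
        PolytopeLift.EmbedsInBoolean C k) ∧
    ∃ k : ℕ, IsLeast {m : ℕ | PolytopeLift.EmbedsInBoolean C m} k ∧
      (k : ℕ∞) ≤ PolytopeLift.nonnegRank C := by
  classical
  have hiff : ∀ k, PolytopeLift.HasBooleanFactorization
      (PolytopeLift.supp (PolytopeLift.slackMatrix C)) k ↔ PolytopeLift.EmbedsInBoolean C k :=
    fun k => ⟨PolytopeLift.embedsInBoolean_of_hasBooleanFactorization hC h0,
      PolytopeLift.hasBooleanFactorization_of_embedsInBoolean hC⟩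
  have : Finite (C.extremePoints ℝ) := hC.finite_extremePoints
  have hex : ∃ k, PolytopeLift.EmbedsInBoolean C k :=
    (PolytopeLift.exists_hasBooleanFactorization _).imp fun k => (hiff k).1
  refine ⟨hiff, Nat.find hex, ⟨Nat.find_spec hex, fun m hm => Nat.find_min' hex hm⟩, ?_⟩
  exact le_iInf₂ fun r hr => Nat.cast_le.2 <|
    Nat.find_min' hex ((hiff r).1 hr.hasBooleanFactorization_supp)
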